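/- Let $H_1$ and $H_2$ be complex Hilbert spaces. For a complex Hilbert space $H$ let $B(H)$ be the C$^*$-algebra of bounded linear operators on $H$, let $\mathcal{B}_{B(H)^+}=\{x\in B(H): x\ge 0,\ \|x\|\le 1\}$ be the positive part of its closed unit ball (with the operator-norm distance), and let $\mathcal{P}roj(B(H))=\{p\in B(H): p=p^*=p^2\}\subseteq \mathcal{B}_{B(H)^+}$ be the set of projections. Let $\Delta:\mathcal{B}_{B(H_1)^+}\to\mathcal{B}_{B(H_2)^+}$ be a surjective (distance-preserving) isometry such that $\Delta(\mathcal{P}roj(B(H_1)))=\mathcal{P}roj(B(H_2))$. Then there exists a surjective complex linear isometry $T:B(H_1)\to B(H_2)$ which is a Jordan $^*$-isomorphism (that is, a bijective complex linear map with $T(a^*)=T(a)^*$ and $T(a\circ b)=T(a)\circ T(b)$ for all $a,b\in B(H_1)$, where $a\circ b=\frac12(ab+ba)$) such that one of the following statements holds: (a) $\Delta(x)=T(x)$ for all $x\in\mathcal{B}_{B(H_1)^+}$; (b) $\Delta(x)=\mathbf{1}-T(x)$ for all $x\in\mathcal{B}_{B(H_1)^+}$. Furthermore, $T$ is a $^*$-isomorphism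 or a $^*$-anti-isomorphism. -/

import Mathlib

/-- The positive part of the closed unit ball of `B(H)`: positive bounded operators of norm at
most one. -/
def posBall (H : Type*) [NormedAddCommGroup H] [InnerProductSpace ℂ H] : Set (H →L[ℂ] H) :=
  {x | x.IsPositive ∧ ‖x‖ ≤ 1}

/-- The lattice of (orthogonal) projections of `B(H)`: operators `p` with `p * p = p` and
`star p = p`. -/
def projections (H : Type*) [NormedAddCommGroup H] [InnerProductSpace ℂ H] [CompleteSpace H] :
    Set (H →L[ℂ] H) :=
  {p | IsStarProjection p}

/-- Every projection belongs to the positive part of the closed unit ball. -/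
theorem projections_subset_posBall (H : Type*) [NormedAddCommGroup H] [InnerProductSpace ℂ H]
    [CompleteSpace H] : projections H ⊆ posBall H := fun p hp =>
  ⟨(ContinuousLinearMap.nonneg_iff_isPositive p).1 (IsStarProjection.nonneg hp),
    IsStarProjection.norm_le p hp⟩

/-- The Jordan product `(a * b + b * a) / 2`. -/
noncomputable def jordanProd {A : Type*} [Ring A] [Algebra ℂ A] (a b : A) : A :=
  (1 / 2 : ℂ) • (a * b + b * a)

/-- A Jordan `*`-homomorphism: a complex linear map preserving the involution and the Jordan
product. -/
structure IsJordanStarHom {A B : Type*} [Ring A] [Algebra ℂ A] [Star A] [Ring B] [Algebra ℂ B]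
    [Star B] (T : A →ₗ[ℂ] B) : Prop where
  map_star : ∀ a : A, T (star a) = star (T a)
  map_jordanProd : ∀ a b : A, T (jordanProd a b) = jordanProd (T a) (T b)

/-- A Jordan `*`-isomorphism: a bijective Jordan `*`-homomorphism. -/
def IsJordanStarIso {A B : Type*} [Ring A] [Algebra ℂ A] [Star A] [Ring B] [Algebra ℂ B]
    [Star B] (T : A →ₗ[ℂ] B) : Prop :=
  IsJordanStarHom T ∧ Function.Bijective T

/-- `T` is a `*`-isomorphism: it underlies an isomorphism of complex `*`-algebras. -/
def IsStarIso {A B : Type*} [Ring A] [Algebra ℂ A] [StarRing A] [Ring B] [Algebra ℂ B]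
    [StarRing B] (T : A →ₗ[ℂ] B) : Prop :=
  ∃ Φ : A ≃⋆ₐ[ℂ] B, ∀ a : A, T a = Φ a

/-- `T` is a `*`-anti-isomorphism: it underlies an isomorphism of complex `*`-algebras onto the
opposite algebra. -/
def IsStarAntiIso {A B : Type*} [Ring A] [Algebra ℂ A] [StarRing A] [Ring B] [Algebra ℂ B]
    [StarRing B] (T : A →ₗ[ℂ] B) : Prop :=
  ∃ Φ : A ≃⋆ₐ[ℂ] Bᵐᵒᵖ, ∀ a : A, MulOpposite.op (T a) = Φ a

/-! ### Mazur–Ulam and Mankiewicz: isometries of closed unit balls -/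

section MazurUlamBall

open Metric

/-! The positive ball is the order interval [0,1], and x ↦ 2x − 1 carries it onto the closed unit
ball of the self-adjoint part, doubling distances. Mankiewicz's theorem
(`exists_linearIsometryEquiv_of_closedBall`) then makes `Δ` affine with a real linear isometry as
linear part, so only Δ(0) has to be located.

A nonzero projection has norm 1, so 0 is at distance 1 from every other projection, and Δ(0)
inherits this. A nontrivial projection of B(H₂) has others at distance less than 1
(`exists_projection_near`), whence Δ(0) is 0 or 1. In the second case 1 − Δ replaces Δ.

Once Δ(0) = 0, the complexified linear part T is unital and positive with positive inverse.
Kadison's inequality (`kadison_inequality`) for T and T⁻¹ gives T(x²) = T(x)², so T is a Jordan map.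
Since B(H₂) is prime, Herstein's theorem (`jordanHom_mul_or_mul_rev`) makes T multiplicative or
anti-multiplicative, hence isometric. -/

/-- A surjective self-isometry of a bounded metric space fixes every centre of symmetry. -/
theorem IsometryEquiv.apply_eq_of_reflection {X : Type*} [MetricSpace X] [BoundedSpace X]
    (ψ : X ≃ᵢ X) (z : X) (hz : ψ z = z) (hψ : ∀ x, dist (ψ x) x = 2 * dist x z) (g : X ≃ᵢ X) :
    g z = z := by
  have key : ∀ n : ℕ, ∀ g : X ≃ᵢ X, 2 ^ n * dist (g z) z ≤ diam (Set.univ : Set X) := by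
    intro n
    induction n with
    | zero =>
      intro g
      simpa using dist_le_diam_of_mem (Bornology.IsBounded.all _) (Set.mem_univ (g z))
        (Set.mem_univ z)
    | succ n ih =>
      intro g
      -- Väisälä's trick: ψ g⁻¹ ψ g moves z twice as far as g does, so a positive displacement would
      -- outgrow the diameter.
      have h := ih (((g.trans ψ).trans g.symm).trans ψ)
      have h2 : dist (ψ (g.symm (ψ (g z)))) z = 2 * dist (g z) z := by
        calc dist (ψ (g.symm (ψ (g z)))) z = dist (ψ (g.symm (ψ (g z)))) (ψ z) := by rw [hz]
          _ = dist (g.symm (ψ (g z))) (g.symm (g z)) := by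
            rw [ψ.dist_eq, g.symm_apply_apply]
          _ = dist (ψ (g z)) (g z) := g.symm.dist_eq _ _
          _ = 2 * dist (g z) z := hψ _
      simp only [IsometryEquiv.trans_apply, h2] at h
      calc 2 ^ (n + 1) * dist (g z) z = 2 ^ n * (2 * dist (g z) z) := by ring
        _ ≤ _ := h
  by_contra hne
  have hpos : 0 < dist (g z) z := dist_pos.2 hne
  obtain ⟨n, hn⟩ := pow_unbounded_of_one_lt (diam (Set.univ : Set X) / dist (g z) z)
    (one_lt_two : (1 : ℝ) < 2)
  rw [div_lt_iff₀ hpos] at hn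
  exact absurd (key n g) (not_le.2 hn)

/-- An isometry between bounded metric spaces maps a centre of symmetry to a centre of symmetry. -/
theorem IsometryEquiv.apply_eq_of_reflections {X Y : Type*} [MetricSpace X] [BoundedSpace X]
    [MetricSpace Y] (ψ : X ≃ᵢ X) (z : X) (hz : ψ z = z)
    (hψ : ∀ x, dist (ψ x) x = 2 * dist x z)
    (φ : Y ≃ᵢ Y) (w : Y) (hφ : ∀ y, dist (φ y) y = 2 * dist y w) (f : X ≃ᵢ Y) :
    f z = w := by
  have h := IsometryEquiv.apply_eq_of_reflection ψ z hz hψ ((f.trans φ).trans f.symm)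
  simp only [IsometryEquiv.trans_apply] at h
  have h2 : φ (f z) = f z := by rw [← f.apply_symm_apply (φ (f z)), h]
  have h3 := hφ (f z)
  rw [h2, dist_self] at h3
  exact dist_eq_zero.1 (by linarith)

variable {E F : Type*} [NormedAddCommGroup E] [NormedAddCommGroup F]

/-- The points at distance at most half of `dist p q` from `p` and `q`. -/
def lens (p q : E) : Set E := {x | dist x p ≤ dist p q / 2 ∧ dist x q ≤ dist p q / 2}

theorem reflection_mem_lens (p q x : E) (hx : x ∈ lens p q) : p + q - x ∈ lens p q := by
  constructor
  · have : dist (p + q - x) p = dist x q := by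
      rw [dist_comm x q, dist_eq_norm, dist_eq_norm]; congr 1; abel
    rw [this]; exact hx.2
  · have : dist (p + q - x) q = dist x p := by
      rw [dist_comm x p, dist_eq_norm, dist_eq_norm]; congr 1; abel
    rw [this]; exact hx.1

/-- Triangle inequality through `p`. The hypothesis involves only ‖p‖ and `dist p q`, which an
isometry fixing 0 preserves, so it also controls the image lens. -/
theorem lens_subset_closedBall {p q : E} (h : ‖p‖ + dist p q / 2 ≤ 1) :
    lens p q ⊆ closedBall 0 1 := by
  intro x hx
  have h1 := hx.1
  rw [dist_eq_norm] at h1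
  rw [mem_closedBall_zero_iff]
  have := norm_add_le (x - p) p
  rw [sub_add_cancel] at this
  linarith

/-- The extension by zero of a map defined on the unit ball. -/
noncomputable def ballExt (f : closedBall (0 : E) 1 ≃ᵢ closedBall (0 : F) 1) (x : E) : F :=
  open Classical in if h : x ∈ closedBall (0 : E) 1 then f ⟨x, h⟩ else 0

theorem ballExt_of_norm_le (f : closedBall (0 : E) 1 ≃ᵢ closedBall (0 : F) 1) {x : E}
    (h : ‖x‖ ≤ 1) :
    ballExt f x = f ⟨x, mem_closedBall_zero_iff.2 h⟩ :=
  dif_pos (mem_closedBall_zero_iff.2 h)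

theorem dist_ballExt (f : closedBall (0 : E) 1 ≃ᵢ closedBall (0 : F) 1) {x y : E}
    (hx : ‖x‖ ≤ 1) (hy : ‖y‖ ≤ 1) :
    dist (ballExt f x) (ballExt f y) = dist x y := by
  rw [ballExt_of_norm_le f hx, ballExt_of_norm_le f hy, ← Subtype.dist_eq, f.dist_eq,
    Subtype.dist_eq]

variable [NormedSpace ℝ E] [NormedSpace ℝ F]

/-- The reflection `x ↦ p + q - x` of a set invariant under it. -/
def reflectionOn (S : Set E) (p q : E) (hS : ∀ x ∈ S, p + q - x ∈ S) : S ≃ᵢ S :=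
  IsometryEquiv.mk' (fun x => ⟨p + q - x, hS x x.2⟩) (fun x => ⟨p + q - x, hS x x.2⟩)
    (fun x => Subtype.ext (by simp)) (Isometry.of_dist_eq fun x y => dist_sub_left _ _ _)

theorem dist_reflectionOn (S : Set E) (p q : E) (hS : ∀ x ∈ S, p + q - x ∈ S) (x z : S)
    (hz : (z : E) = (2⁻¹ : ℝ) • (p + q)) :
    dist (reflectionOn S p q hS x) x = 2 * dist x z := by
  have h : p + q - (x : E) - x = (-2 : ℝ) • ((x : E) - z) := by
    rw [hz]; module
  rw [Subtype.dist_eq, Subtype.dist_eq, dist_eq_norm, dist_eq_norm]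
  change ‖p + q - (x : E) - x‖ = _
  rw [h, norm_smul]
  norm_num

theorem reflectionOn_center (S : Set E) (p q : E) (hS : ∀ x ∈ S, p + q - x ∈ S) (z : S)
    (hz : (z : E) = (2⁻¹ : ℝ) • (p + q)) : reflectionOn S p q hS z = z := by
  have := dist_reflectionOn S p q hS z z hz
  rw [dist_self, mul_zero] at this
  exact dist_eq_zero.1 this

theorem midpoint_mem_lens (p q : E) : (2⁻¹ : ℝ) • (p + q) ∈ lens p q := by
  have h1 : (2⁻¹ : ℝ) • (p + q) - p = (-2⁻¹ : ℝ) • (p - q) := by module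
  have h2 : (2⁻¹ : ℝ) • (p + q) - q = (2⁻¹ : ℝ) • (p - q) := by module
  constructor <;> rw [dist_eq_norm, dist_eq_norm]
  · rw [h1, norm_smul]; norm_num; linarith
  · rw [h2, norm_smul]; norm_num; linarith

/-- The restriction of a partially defined isometry to lenses inside the domain. -/
def lensIsometry {S : Set E} {S' : Set F} (f : S ≃ᵢ S') (p q : S) (h : lens (p : E) q ⊆ S)
    (h' : lens (f p : F) (f q) ⊆ S') : lens (p : E) q ≃ᵢ lens (f p : F) (f q) :=
  IsometryEquiv.mk'
    (fun x => ⟨f ⟨x, h x.2⟩, by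
      have hx := x.2
      constructor
      · rw [← Subtype.dist_eq, ← Subtype.dist_eq, f.dist_eq, f.dist_eq]; exact hx.1
      · rw [← Subtype.dist_eq, ← Subtype.dist_eq, f.dist_eq, f.dist_eq]; exact hx.2⟩)
    (fun y => ⟨f.symm ⟨y, h' y.2⟩, by
      have hy := y.2
      constructor
      · rw [← Subtype.dist_eq, ← Subtype.dist_eq, ← f.dist_eq _ p, ← f.dist_eq p q,
          f.apply_symm_apply]
        exact hy.1
      · rw [← Subtype.dist_eq, ← Subtype.dist_eq, ← f.dist_eq _ q, ← f.dist_eq p q,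
          f.apply_symm_apply]
        exact hy.2⟩)
    (fun y => Subtype.ext (by simp))
    (Isometry.of_dist_eq fun x y => f.dist_eq ⟨x, h x.2⟩ ⟨y, h y.2⟩)

/-- A surjective isometry between subsets of normed spaces preserves the midpoints of pairs whose
lens is contained in the domain and whose image lens is contained in the range. -/
theorem map_midpoint_of_lens_subset {S : Set E} {S' : Set F} (f : S ≃ᵢ S') (p q : S)
    (h : lens (p : E) q ⊆ S) (h' : lens (f p : F) (f q) ⊆ S') :
    (f ⟨(2⁻¹ : ℝ) • ((p : E) + q), h (midpoint_mem_lens _ _)⟩ : F) =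
      (2⁻¹ : ℝ) • ((f p : F) + f q) := by
  have : BoundedSpace (lens (p : E) q) := by
    apply Bornology.IsBounded.boundedSpace_val
    exact isBounded_closedBall.subset fun x hx => hx.1
  have key := IsometryEquiv.apply_eq_of_reflections
    (reflectionOn (lens (p : E) q) p q (reflection_mem_lens _ _))
    ⟨_, midpoint_mem_lens _ _⟩ (reflectionOn_center _ _ _ _ _ rfl)
    (fun x => dist_reflectionOn _ _ _ _ _ _ rfl)
    (reflectionOn (lens (f p : F) (f q)) (f p) (f q) (reflection_mem_lens _ _))
    ⟨_, midpoint_mem_lens _ _⟩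
    (fun x => dist_reflectionOn _ _ _ _ _ _ rfl) (lensIsometry f p q h h')
  exact congrArg Subtype.val key

/-- The origin is the centre of symmetry of the ball; x ↦ −x is the reflection with p = q = 0. -/
theorem map_zero_of_closedBall (f : closedBall (0 : E) 1 ≃ᵢ closedBall (0 : F) 1) :
    (f ⟨0, by simp⟩ : F) = 0 := by
  have : BoundedSpace (closedBall (0 : E) 1) :=
    Bornology.IsBounded.boundedSpace_val isBounded_closedBall
  have key := IsometryEquiv.apply_eq_of_reflections
    (reflectionOn (closedBall (0 : E) 1) 0 0 (by simp))
    ⟨0, by simp⟩ (reflectionOn_center _ _ _ _ _ (by simp))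
    (fun x => dist_reflectionOn _ _ _ _ _ _ (by simp))
    (reflectionOn (closedBall (0 : F) 1) 0 0 (by simp))
    ⟨0, by simp⟩
    (fun x => dist_reflectionOn _ _ _ _ _ _ (by simp)) f
  exact congrArg Subtype.val key

theorem norm_map_of_closedBall (f : closedBall (0 : E) 1 ≃ᵢ closedBall (0 : F) 1)
    (x : closedBall (0 : E) 1) : ‖(f x : F)‖ = ‖(x : E)‖ := by
  have h := f.dist_eq x ⟨0, by simp⟩
  rw [Subtype.dist_eq, Subtype.dist_eq, map_zero_of_closedBall f] at h
  simpa using h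

theorem map_midpoint_of_closedBall (f : closedBall (0 : E) 1 ≃ᵢ closedBall (0 : F) 1)
    (p q m : closedBall (0 : E) 1) (h : ‖(p : E)‖ + dist p q / 2 ≤ 1)
    (hm : (m : E) = (2⁻¹ : ℝ) • ((p : E) + q)) :
    (f m : F) = (2⁻¹ : ℝ) • ((f p : F) + f q) := by
  have h1 : lens (p : E) q ⊆ closedBall 0 1 := lens_subset_closedBall h
  have h2 : lens (f p : F) (f q) ⊆ closedBall 0 1 := lens_subset_closedBall (by
    rw [← Subtype.dist_eq, f.dist_eq, norm_map_of_closedBall]; exact h)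
  rw [← map_midpoint_of_lens_subset f p q h1 h2]
  congr 2
  exact Subtype.ext hm

variable (f : closedBall (0 : E) 1 ≃ᵢ closedBall (0 : F) 1)

theorem ballExt_half {x : E} (h : ‖x‖ ≤ 1) :
    ballExt f ((2⁻¹ : ℝ) • x) = (2⁻¹ : ℝ) • ballExt f x := by
  have h' : ‖(2⁻¹ : ℝ) • x‖ ≤ 1 := by rw [norm_smul]; norm_num; linarith [norm_nonneg x]
  rw [ballExt_of_norm_le f h, ballExt_of_norm_le f h',
    map_midpoint_of_closedBall f ⟨0, by simp⟩ ⟨x, mem_closedBall_zero_iff.2 h⟩, map_zero_of_closedBall,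
    zero_add]
  · rw [Subtype.dist_eq]; simp; linarith
  · simp

/-- The radius 1/2 guarantees ‖x‖ + dist x y / 2 ≤ 1, so the midpoint is preserved; halving is then
cancelled. -/
theorem ballExt_add {x y : E} (hx : ‖x‖ ≤ 2⁻¹) (hy : ‖y‖ ≤ 2⁻¹) :
    ballExt f (x + y) = ballExt f x + ballExt f y := by
  have hxy : ‖x + y‖ ≤ 1 := by linarith [norm_add_le x y]
  have hm : ‖(2⁻¹ : ℝ) • (x + y)‖ ≤ 1 := by
    rw [norm_smul]; norm_num; linarith [norm_nonneg (x + y)]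
  have hx1 : ‖x‖ ≤ 1 := by linarith
  have hy1 : ‖y‖ ≤ 1 := by linarith
  have h := ballExt_half f hxy
  rw [ballExt_of_norm_le f hm, map_midpoint_of_closedBall f
    ⟨x, mem_closedBall_zero_iff.2 hx1⟩ ⟨y, mem_closedBall_zero_iff.2 hy1⟩ _ ?_ rfl] at h
  · rw [ballExt_of_norm_le f hx1, ballExt_of_norm_le f hy1]
    exact (smul_right_injective F (by norm_num : (2⁻¹ : ℝ) ≠ 0) h).symm
  · rw [Subtype.dist_eq, dist_eq_norm]
    have := norm_sub_le x y
    simp only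
    linarith

theorem ballExt_two_pow_aux (n : ℕ) {x : E} (h : ‖x‖ ≤ 1) :
    ballExt f (((2 : ℝ)⁻¹ ^ n) • x) = ((2 : ℝ)⁻¹ ^ n) • ballExt f x := by
  induction n with
  | zero => simp
  | succ n ih =>
    have h2 : ‖((2 : ℝ)⁻¹ ^ n) • x‖ ≤ 1 := by
      rw [norm_smul, norm_pow, norm_inv, Real.norm_ofNat]
      exact mul_le_one₀ (pow_le_one₀ (by norm_num) (by norm_num)) (norm_nonneg _) h
    rw [pow_succ', mul_smul, mul_smul, ballExt_half f h2, ih]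

/-- The homogeneous extension of an isometry of unit balls to the whole space. -/
noncomputable def homExt (x : E) : F :=
  ((2 : ℝ) ^ ⌈‖x‖⌉₊) • ballExt f (((2 : ℝ)⁻¹ ^ ⌈‖x‖⌉₊) • x)

theorem norm_inv_pow_smul_le {x : E} {n : ℕ} (hn : ‖x‖ ≤ 2 ^ n) :
    ‖((2 : ℝ)⁻¹ ^ n) • x‖ ≤ 1 := by
  rw [norm_smul, norm_pow, norm_inv, Real.norm_ofNat, inv_pow]
  rw [inv_mul_le_iff₀ (by positivity)]; simpa using hn

/-- Halving commutes with the ball map, so the scaling exponent is irrelevant as soon as the scaled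
vector lies in the ball. Several vectors can thus share one exponent. -/
theorem homExt_eq {x : E} {n : ℕ} (hn : ‖x‖ ≤ 2 ^ n) :
    homExt f x = ((2 : ℝ) ^ n) • ballExt f (((2 : ℝ)⁻¹ ^ n) • x) := by
  have aux : ∀ a k : ℕ, ‖x‖ ≤ 2 ^ a →
      ((2 : ℝ) ^ (k + a)) • ballExt f (((2 : ℝ)⁻¹ ^ (k + a)) • x) =
      ((2 : ℝ) ^ a) • ballExt f (((2 : ℝ)⁻¹ ^ a) • x) := by
    intro a k ha
    rw [pow_add (2 : ℝ)⁻¹, mul_smul, ballExt_two_pow_aux f k (norm_inv_pow_smul_le ha), smul_smul,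
      pow_add, mul_right_comm, ← mul_pow, mul_inv_cancel₀ two_ne_zero, one_pow, one_mul]
  have h0 : ‖x‖ ≤ 2 ^ ⌈‖x‖⌉₊ :=
    (Nat.le_ceil _).trans (by exact_mod_cast Nat.lt_two_pow_self.le)
  rw [homExt, ← aux _ n h0, ← aux n ⌈‖x‖⌉₊ hn, add_comm]

theorem exists_two_pow_ge (r : ℝ) : ∃ n : ℕ, r ≤ 2 ^ n :=
  (pow_unbounded_of_one_lt r one_lt_two).imp fun _ h => h.le

theorem homExt_add (x y : E) : homExt f (x + y) = homExt f x + homExt f y := by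
  -- The factor 2 puts the scaled vectors in the half ball, where additivity is available.
  obtain ⟨n, hn⟩ := exists_two_pow_ge (2 * (‖x‖ + ‖y‖))
  have hx : ‖x‖ ≤ 2 ^ n := by linarith [norm_nonneg x, norm_nonneg y]
  have hy : ‖y‖ ≤ 2 ^ n := by linarith [norm_nonneg x, norm_nonneg y]
  have hxy : ‖x + y‖ ≤ 2 ^ n := by linarith [norm_nonneg x, norm_nonneg y, norm_add_le x y]
  have half : ∀ z : E, 2 * ‖z‖ ≤ 2 ^ n → ‖((2 : ℝ)⁻¹ ^ n) • z‖ ≤ 2⁻¹ := by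
    intro z hz
    have := norm_inv_pow_smul_le (x := (2 : ℝ) • z) (n := n) (by simpa [norm_smul] using hz)
    rw [smul_comm, norm_smul, Real.norm_ofNat] at this
    linarith
  rw [homExt_eq f hx, homExt_eq f hy, homExt_eq f hxy, smul_add, ballExt_add f, smul_add]
  · exact half x (by linarith [norm_nonneg y])
  · exact half y (by linarith [norm_nonneg x])

theorem dist_homExt (x y : E) : dist (homExt f x) (homExt f y) = dist x y := by
  obtain ⟨n, hn⟩ := exists_two_pow_ge (‖x‖ + ‖y‖)
  have hx : ‖x‖ ≤ 2 ^ n := by linarith [norm_nonneg x, norm_nonneg y]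
  have hy : ‖y‖ ≤ 2 ^ n := by linarith [norm_nonneg x, norm_nonneg y]
  rw [homExt_eq f hx, homExt_eq f hy, dist_smul₀,
    dist_ballExt f (norm_inv_pow_smul_le hx) (norm_inv_pow_smul_le hy), dist_smul₀, ← mul_assoc,
    ← norm_mul, ← mul_pow, mul_inv_cancel₀ two_ne_zero, one_pow, norm_one, one_mul]

theorem homExt_coe (x : closedBall (0 : E) 1) : homExt f x = f x := by
  have hx : ‖(x : E)‖ ≤ 1 := mem_closedBall_zero_iff.1 x.2
  rw [homExt_eq f (n := 0) (by simpa using hx), ballExt_of_norm_le f (by simpa using hx)]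
  simp

/-- A surjective isometry between closed unit balls of real normed spaces extends to a surjective
linear isometry (Mankiewicz). -/
theorem exists_linearIsometryEquiv_of_closedBall :
    ∃ L : E ≃ₗᵢ[ℝ] F, ∀ x : closedBall (0 : E) 1, (f x : F) = L x := by
  have hadd := homExt_add f
  have hdist : Isometry (homExt f) := Isometry.of_dist_eq (dist_homExt f)
  let A : E →+ F := AddMonoidHom.mk' (homExt f) hadd
  let L₀ : E →L[ℝ] F := A.toRealLinearMap hdist.continuous
  have hL₀ : ∀ x, L₀ x = homExt f x := fun x => rfl
  let L₁ : E →ₗᵢ[ℝ] F := ⟨L₀.toLinearMap, fun x => by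
    have := hdist.dist_eq x 0
    rw [← hL₀, ← hL₀, map_zero] at this
    simpa using this⟩
  have hL₁ : ∀ x, L₁ x = homExt f x := fun x => rfl
  have hsurj : Function.Surjective L₁ := by
    intro y
    obtain ⟨n, hn⟩ := exists_two_pow_ge ‖y‖
    let w : closedBall (0 : F) 1 :=
      ⟨((2 : ℝ)⁻¹ ^ n) • y, mem_closedBall_zero_iff.2 (norm_inv_pow_smul_le hn)⟩
    refine ⟨(2 : ℝ) ^ n • (f.symm w : E), ?_⟩
    rw [map_smul, hL₁, homExt_coe, f.apply_symm_apply, smul_smul, ← mul_pow,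
      mul_inv_cancel₀ two_ne_zero, one_pow, one_smul]
  exact ⟨LinearIsometryEquiv.ofSurjective L₁ hsurj, fun x => (homExt_coe f x).symm⟩

end MazurUlamBall

/-! ### Herstein's theorem: Jordan homomorphisms onto prime rings -/

section JordanPrime

/-- An abelian group is not a union of two proper kernels. -/
theorem AddMonoidHom.eq_zero_or_eq_zero {M N P : Type*} [AddGroup M] [AddGroup N] [AddGroup P]
    (f : M →+ N) (g : M →+ P) (h : ∀ x, f x = 0 ∨ g x = 0) :
    (∀ x, f x = 0) ∨ (∀ x, g x = 0) := by
  by_contra! hc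
  obtain ⟨⟨x, hx⟩, ⟨y, hy⟩⟩ := hc
  have hgx := (h x).resolve_left hx
  have hfy := (h y).resolve_right hy
  rcases h (x + y) with h1 | h1
  · rw [map_add, hfy, add_zero] at h1; exact hx h1
  · rw [map_add, hgx, zero_add] at h1; exact hy h1

variable {R S : Type*} [Ring R] [Ring S]

theorem eq_zero_of_add_self_of_two_torsionFree (h2 : ∀ s : S, s + s = 0 → s = 0) {s t : S}
    (h : s + s = t + t) : s = t := by
  rw [← sub_eq_zero]
  apply h2
  rw [← sub_eq_zero] at h
  rw [← h]; abel

/-- Exchanging u and v twice shows that (uxv)y(uxv) equals its own negative, hence vanishes.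
Primeness gives uxv = 0 for each x, and a second use of primeness finishes. -/
theorem eq_zero_or_eq_zero_of_mul_mul_add_eq_zero (h2 : ∀ s : S, s + s = 0 → s = 0)
    (hprime : ∀ u v : S, (∀ x, u * x * v = 0) → u = 0 ∨ v = 0) {u v : S}
    (h : ∀ x, u * x * v + v * x * u = 0) : u = 0 ∨ v = 0 := by
  apply hprime
  intro x
  have h' : ∀ x, v * x * u = -(u * x * v) := fun x => by
    rw [eq_neg_iff_add_eq_zero, add_comm]; exact h x
  have key : ∀ y, (u * x * v) * y * (u * x * v) = 0 := by
    intro y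
    apply h2
    have e1 : (u * x * v) * y * (u * x * v) = -(u * (x * u * y) * v * x * v) := by
      calc (u * x * v) * y * (u * x * v) = u * x * (v * y * u) * x * v := by noncomm_ring
        _ = _ := by rw [h' y]; noncomm_ring
    have e2 : u * (x * u * y) * v * x * v = (u * x * v) * y * (u * x * v) := by
      have := h' (x * u * y)
      calc u * (x * u * y) * v * x * v = -(v * (x * u * y) * u) * x * v := by rw [this]; noncomm_ring
        _ = -(v * x * u) * y * (u * x * v) := by noncomm_ring
        _ = _ := by rw [h' x]; noncomm_ring
    nth_rewrite 1 [e1]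
    rw [e2]; abel
  rcases hprime _ _ key with h | h <;> exact h

variable (φ : R →+ S) (h2 : ∀ s : S, s + s = 0 → s = 0)
  (hφ : ∀ a b, φ (a * b + b * a) = φ a * φ b + φ b * φ a)

include h2 hφ

/-- Writing {a,b} = ab + ba, one has 2aba = {a,{a,b}} − {a²,b}. -/
theorem jordanHom_map_mul_mul_self (a b : R) : φ (a * b * a) = φ a * φ b * φ a := by
  apply eq_zero_of_add_self_of_two_torsionFree h2
  have hsq : φ (a * a) = φ a * φ a := by
    apply eq_zero_of_add_self_of_two_torsionFree h2
    rw [← map_add, hφ]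
  have e : a * b * a + a * b * a = (a * (a * b + b * a) + (a * b + b * a) * a) -
      ((a * a) * b + b * (a * a)) := by noncomm_ring
  rw [← map_add, e, map_sub, hφ, hφ, hφ, hsq]
  noncomm_ring

theorem jordanHom_map_triple (a b c : R) :
    φ (a * b * c + c * b * a) = φ a * φ b * φ c + φ c * φ b * φ a := by
  have h := jordanHom_map_mul_mul_self φ h2 hφ (a + c) b
  have e : (a + c) * b * (a + c) = a * b * a + (a * b * c + c * b * a) + c * b * c := by
    noncomm_ring
  rw [e, map_add, map_add, jordanHom_map_mul_mul_self φ h2 hφ, jordanHom_map_mul_mul_self φ h2 hφ,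
    map_add φ a c] at h
  have e2 : (φ a + φ c) * φ b * (φ a + φ c) =
      φ a * φ b * φ a + (φ a * φ b * φ c + φ c * φ b * φ a) + φ c * φ b * φ c := by noncomm_ring
  rw [e2] at h
  exact add_left_cancel (add_right_cancel h)

/-- The element (ab)x(ba) + (ba)x(ab) also equals a(bxb)a + b(axa)b. Its image is computed from both
forms, with φ(ba) eliminated by the Jordan identity. -/
theorem jordanHom_defect_identity (a b x : R) :
    (φ (a * b) - φ a * φ b) * φ x * (φ (a * b) - φ b * φ a) +
      (φ (a * b) - φ b * φ a) * φ x * (φ (a * b) - φ a * φ b) = 0 := by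
  have h1 := jordanHom_map_triple φ h2 hφ (a * b) x (b * a)
  have e : (a * b) * x * (b * a) + (b * a) * x * (a * b) = a * (b * x * b) * a + b * (a * x * a) * b := by
    noncomm_ring
  have hba : φ (b * a) = φ a * φ b + φ b * φ a - φ (a * b) := by
    rw [← hφ, map_add]; abel
  rw [e, map_add, jordanHom_map_mul_mul_self φ h2 hφ, jordanHom_map_mul_mul_self φ h2 hφ,
    jordanHom_map_mul_mul_self φ h2 hφ, jordanHom_map_mul_mul_self φ h2 hφ, hba] at h1
  rw [← sub_eq_zero] at h1
  rw [← h1]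
  noncomm_ring

/-- A Jordan homomorphism onto a prime ring without 2-torsion is a homomorphism or an
anti-homomorphism (Herstein, Smiley). -/
theorem jordanHom_mul_or_mul_rev (hprime : ∀ u v : S, (∀ x, u * x * v = 0) → u = 0 ∨ v = 0)
    (hsurj : Function.Surjective φ) :
    (∀ a b, φ (a * b) = φ a * φ b) ∨ (∀ a b, φ (a * b) = φ b * φ a) := by
  let M : R →+ R →+ S := (AddMonoidHom.mul (R := R)).compr₂ φ
  let F : R →+ R →+ S := M - ((AddMonoidHom.mul (R := S)).comp φ).compl₂ φ
  let G : R →+ R →+ S := M - ((AddMonoidHom.mul (R := S)).flip.comp φ).compl₂ φ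
  have hF : ∀ a b, F a b = φ (a * b) - φ a * φ b := fun a b => rfl
  have hG : ∀ a b, G a b = φ (a * b) - φ b * φ a := fun a b => rfl
  have hpair : ∀ a b, F a b = 0 ∨ G a b = 0 := by
    intro a b
    refine eq_zero_or_eq_zero_of_mul_mul_add_eq_zero h2 hprime fun x => ?_
    obtain ⟨x, rfl⟩ := hsurj x
    exact jordanHom_defect_identity φ h2 hφ a b x
  -- The pointwise alternative is made uniform first in b for fixed a, then in a.
  have hall : ∀ a, F a = 0 ∨ G a = 0 := fun a =>
    (AddMonoidHom.eq_zero_or_eq_zero (F a) (G a) (hpair a)).imp (fun h => AddMonoidHom.ext h)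
      (fun h => AddMonoidHom.ext h)
  refine (AddMonoidHom.eq_zero_or_eq_zero F G hall).imp (fun h a b => ?_) (fun h a b => ?_)
  · rw [← sub_eq_zero, ← hF, h]; rfl
  · rw [← sub_eq_zero, ← hG, h]; rfl

end JordanPrime

/-! ### Kadison's inequality through Bernstein polynomials -/

section Kadison

variable {A B : Type*} [CStarAlgebra A] [PartialOrder A] [StarOrderedRing A]
  [CStarAlgebra B] [PartialOrder B] [StarOrderedRing B]

/-- The operator Cauchy-Schwarz inequality for a partition of unity. -/
theorem sq_sum_smul_le_of_sum_eq_one {ι : Type*} (s : Finset ι) (a : ι → B)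
    (ha : ∀ i ∈ s, 0 ≤ a i) (hsum : ∑ i ∈ s, a i = 1) (c : ι → ℝ) :
    (∑ i ∈ s, c i • a i) * (∑ i ∈ s, c i • a i) ≤ ∑ i ∈ s, (c i * c i) • a i := by
  set y := ∑ i ∈ s, c i • a i with hy
  have hya : IsSelfAdjoint y := by
    rw [hy, isSelfAdjoint_iff, star_sum]
    refine Finset.sum_congr rfl fun i hi => ?_
    rw [star_smul, (IsSelfAdjoint.of_nonneg (ha i hi)).star_eq, star_trivial]
  -- This is a variance: since the `a i` sum to 1, it expands to Σ cᵢ² aᵢ − y².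
  have key : 0 ≤ ∑ i ∈ s, star (c i • (1 : B) - y) * a i * (c i • (1 : B) - y) :=
    Finset.sum_nonneg fun i hi => star_left_conjugate_nonneg (ha i hi) _
  have e : ∀ i, star (c i • (1 : B) - y) * a i * (c i • (1 : B) - y) =
      (c i * c i) • a i - (c i • a i) * y - y * (c i • a i) + y * a i * y := by
    intro i
    rw [star_sub, star_smul, star_one, star_trivial, hya.star_eq]
    simp only [sub_mul, mul_sub, smul_mul_assoc, mul_smul_comm, one_mul, mul_one, smul_sub,
      smul_smul]
    abel
  simp only [e, Finset.sum_add_distrib, Finset.sum_sub_distrib, ← Finset.sum_mul,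
    ← Finset.mul_sum, hsum, ← hy] at key
  rw [← sub_nonneg]
  convert key using 1
  noncomm_ring

theorem aeval_bernsteinPolynomial_nonneg {x : A} (h0 : 0 ≤ x) (h1 : x ≤ 1) (n i : ℕ) :
    0 ≤ Polynomial.aeval x (bernsteinPolynomial ℝ n i) := by
  have hx : 0 ≤ 1 - x := sub_nonneg.2 h1
  have hc : Commute (x ^ i) ((1 - x) ^ (n - i)) :=
    (((Commute.one_right x).sub_right (Commute.refl x)).pow_pow _ _)
  have hp : 0 ≤ x ^ i * (1 - x) ^ (n - i) :=
    Commute.mul_nonneg (CStarAlgebra.pow_nonneg h0 i) (CStarAlgebra.pow_nonneg hx _) hc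
  have e : Polynomial.aeval x (bernsteinPolynomial ℝ n i) =
      (n.choose i) • (x ^ i * (1 - x) ^ (n - i)) := by
    simp [bernsteinPolynomial, mul_assoc]
  rw [e]
  exact nsmul_nonneg hp _

/-- The images of the Bernstein polynomials at x form a positive partition of unity. Their first two
moments are those of a binomial law, with x and x² replaced by T x and T(x²), so Cauchy–Schwarz with
weights i gives the bound. -/
theorem kadison_aux (T : A →ₗ[ℝ] B) (hT : ∀ a, 0 ≤ a → 0 ≤ T a) (hone : T 1 = 1)
    {x : A} (h0 : 0 ≤ x) (h1 : x ≤ 1) (n : ℕ) :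
    0 ≤ ((n : ℝ) * n) • (T (x * x) - T x * T x) + (n : ℝ) • (T x - T (x * x)) := by
  let a : ℕ → B := fun i => T (Polynomial.aeval x (bernsteinPolynomial ℝ n i))
  have hsum : ∑ i ∈ Finset.range (n + 1), a i = 1 := by
    rw [← map_sum, ← map_sum, bernsteinPolynomial.sum, map_one, hone]
  have hs1 : ∑ i ∈ Finset.range (n + 1), (i : ℝ) • a i = (n : ℝ) • T x := by
    simp only [a, ← map_smul]
    rw [← map_sum, ← map_sum]
    simp only [Nat.cast_smul_eq_nsmul]
    rw [bernsteinPolynomial.sum_smul, map_nsmul, Polynomial.aeval_X]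
  have hs2 : ∑ i ∈ Finset.range (n + 1), ((i : ℝ) * ((i : ℝ) - 1)) • a i =
      ((n : ℝ) * ((n : ℝ) - 1)) • T (x * x) := by
    -- Truncated subtraction is harmless: at m = 0 the factor m kills both sides.
    have hcast : ∀ m : ℕ, ((m : ℝ) * ((m : ℝ) - 1)) = ((m * (m - 1) : ℕ) : ℝ) := by
      intro m
      cases m <;> simp
    simp only [a, ← map_smul, hcast]
    rw [← map_sum, ← map_sum]
    simp only [Nat.cast_smul_eq_nsmul]
    rw [bernsteinPolynomial.sum_mul_smul, map_nsmul, map_pow, Polynomial.aeval_X, pow_two]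
  have h := sq_sum_smul_le_of_sum_eq_one (Finset.range (n + 1)) a
    (fun i _ => hT _ (aeval_bernsteinPolynomial_nonneg h0 h1 n i)) hsum (fun i => (i : ℝ))
  have hs3 : ∑ i ∈ Finset.range (n + 1), ((i : ℝ) * i) • a i =
      ((n : ℝ) * ((n : ℝ) - 1)) • T (x * x) + (n : ℝ) • T x := by
    rw [← hs1, ← hs2, ← Finset.sum_add_distrib]
    exact Finset.sum_congr rfl fun i _ => by module
  rw [hs1, hs3, ← sub_nonneg] at h
  convert h using 1
  simp only [smul_mul_assoc, mul_smul_comm]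
  module

/-- Kadison's inequality for a unital positive map. -/
theorem kadison_inequality (T : A →ₗ[ℝ] B) (hT : ∀ a, 0 ≤ a → 0 ≤ T a) (hone : T 1 = 1)
    {x : A} (h0 : 0 ≤ x) (h1 : x ≤ 1) : T x * T x ≤ T (x * x) := by
  rw [← sub_nonneg]
  have hlim : Filter.Tendsto (fun n : ℕ => (T (x * x) - T x * T x) +
      ((1 : ℝ) / (n + 1)) • (T x - T (x * x))) Filter.atTop
      (nhds ((T (x * x) - T x * T x) + (0 : ℝ) • (T x - T (x * x)))) :=
    tendsto_const_nhds.add (tendsto_one_div_add_atTop_nhds_zero_nat.smul_const _)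
  rw [zero_smul, add_zero] at hlim
  refine CStarAlgebra.isClosed_nonneg.mem_of_tendsto hlim (Filter.Eventually.of_forall fun n => ?_)
  -- Dividing by (n + 1)² leaves an error of order 1/(n + 1); the shift avoids division by zero.
  have h := kadison_aux T hT hone h0 h1 (n + 1)
  have hn : (0 : ℝ) < n + 1 := by positivity
  have h' := smul_nonneg (inv_nonneg.2 (mul_pos hn hn).le) h
  push_cast at h'
  rw [smul_add, smul_smul, smul_smul, inv_mul_cancel₀ (mul_pos hn hn).ne', one_smul] at h'
  have e : (((n : ℝ) + 1) * (n + 1))⁻¹ * (n + 1) = 1 / (n + 1) := by field_simp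
  rwa [e] at h'

end Kadison

/-! ### The order interval [0,1] as a self-adjoint unit ball -/

section UnitInterval

variable {A B : Type*} [CStarAlgebra A] [PartialOrder A] [StarOrderedRing A]
  [CStarAlgebra B] [PartialOrder B] [StarOrderedRing B]

theorem half_one_add_mem_Icc (s : selfAdjoint A) (hs : ‖s‖ ≤ 1) :
    (2⁻¹ : ℝ) • (1 + (s : A)) ∈ Set.Icc (0 : A) 1 := by
  have hsa : IsSelfAdjoint (s : A) := s.2
  have hs' : ‖(s : A)‖ ≤ 1 := hs
  have h1 : (s : A) ≤ 1 := by
    refine hsa.le_algebraMap_norm_self.trans ?_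
    simpa using algebraMap_mono A hs'
  have h2 : -1 ≤ (s : A) := by
    refine le_trans ?_ hsa.neg_algebraMap_norm_le_self
    simpa using algebraMap_mono A hs'
  constructor
  · exact smul_nonneg (by norm_num) (by simpa [add_comm] using neg_le_iff_add_nonneg.1 h2)
  · rw [← sub_nonneg]
    have : (1 : A) - (2⁻¹ : ℝ) • (1 + (s : A)) = (2⁻¹ : ℝ) • (1 - (s : A)) := by module
    rw [this]
    exact smul_nonneg (by norm_num) (sub_nonneg.2 h1)

/-- Since (2x − 1)² = 1 − 4x(1 − x) ≤ 1, the C⋆-identity bounds the norm. -/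
theorem norm_two_smul_sub_one_le {x : A} (hx : x ∈ Set.Icc (0 : A) 1) :
    ‖(2 : ℝ) • x - 1‖ ≤ 1 := by
  have hxa : IsSelfAdjoint x := IsSelfAdjoint.of_nonneg hx.1
  have hsa : IsSelfAdjoint ((2 : ℝ) • x - 1) :=
    ((IsSelfAdjoint.all (2 : ℝ)).smul hxa).sub (IsSelfAdjoint.one A)
  have hnn : 0 ≤ ((2 : ℝ) • x - 1) * ((2 : ℝ) • x - 1) := hsa.mul_self_nonneg
  have hle : ((2 : ℝ) • x - 1) * ((2 : ℝ) • x - 1) ≤ 1 := by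
    have h : 0 ≤ x * (1 - x) := Commute.mul_nonneg hx.1 (sub_nonneg.2 hx.2)
      ((Commute.one_right x).sub_right (Commute.refl x))
    have h4 : 0 ≤ (4 : ℝ) • (x * (1 - x)) := smul_nonneg (by norm_num) h
    rw [← sub_nonneg]
    convert h4 using 1
    simp only [mul_sub, sub_mul, smul_mul_assoc, mul_smul_comm, one_mul, mul_one]
    module
  have h := (CStarAlgebra.norm_le_one_iff_of_nonneg _ hnn).2 hle
  rw [hsa.norm_mul_self] at h
  exact (sq_le_one_iff₀ (norm_nonneg _)).1 h

/-- The affine bijection `s ↦ (1 + s) / 2` of the self-adjoint unit ball onto the order interval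
`[0, 1]`. -/
noncomputable def ballEquivIcc (A : Type*) [CStarAlgebra A] [PartialOrder A] [StarOrderedRing A] :
    Metric.closedBall (0 : selfAdjoint A) 1 ≃ Set.Icc (0 : A) 1 where
  toFun s := ⟨(2⁻¹ : ℝ) • (1 + ((s : selfAdjoint A) : A)),
    half_one_add_mem_Icc _ (mem_closedBall_zero_iff.1 s.2)⟩
  invFun x := ⟨⟨(2 : ℝ) • (x : A) - 1, ((IsSelfAdjoint.all (2 : ℝ)).smul
    (IsSelfAdjoint.of_nonneg x.2.1)).sub (IsSelfAdjoint.one A)⟩,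
    mem_closedBall_zero_iff.2 (norm_two_smul_sub_one_le x.2)⟩
  left_inv s := by
    apply Subtype.ext; apply Subtype.ext
    simp [smul_smul]
  right_inv x := by
    apply Subtype.ext
    simp [smul_smul]

theorem dist_ballEquivIcc (s t : Metric.closedBall (0 : selfAdjoint A) 1) :
    dist (ballEquivIcc A s) (ballEquivIcc A t) = 2⁻¹ * dist s t := by
  change dist ((2⁻¹ : ℝ) • (1 + ((s : selfAdjoint A) : A)))
    ((2⁻¹ : ℝ) • (1 + ((t : selfAdjoint A) : A))) = _
  rw [dist_smul₀, dist_add_left]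
  norm_num
  rfl

/-- A surjective isometry between the order intervals `[0, 1]` of two C⋆-algebras is the
restriction of an affine isometry between the self-adjoint parts. -/
theorem exists_linearIsometryEquiv_of_Icc (Δ : Set.Icc (0 : A) 1 ≃ᵢ Set.Icc (0 : B) 1) :
    ∃ L : selfAdjoint A ≃ₗᵢ[ℝ] selfAdjoint B, ∀ x : Set.Icc (0 : A) 1,
      (Δ x : B) = (2⁻¹ : ℝ) • (1 - (L 1 : B)) +
        (L ⟨x, IsSelfAdjoint.of_nonneg x.2.1⟩ : B) := by
  let f : Metric.closedBall (0 : selfAdjoint A) 1 ≃ᵢ Metric.closedBall (0 : selfAdjoint B) 1 :=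
    ⟨(ballEquivIcc A).trans (Δ.toEquiv.trans (ballEquivIcc B).symm),
      Isometry.of_dist_eq fun s t => by
        have h := dist_ballEquivIcc ((ballEquivIcc B).symm (Δ (ballEquivIcc A s)))
          ((ballEquivIcc B).symm (Δ (ballEquivIcc A t)))
        rw [Equiv.apply_symm_apply, Equiv.apply_symm_apply, Δ.dist_eq, dist_ballEquivIcc] at h
        have h' : dist ((ballEquivIcc B).symm (Δ (ballEquivIcc A s)))
          ((ballEquivIcc B).symm (Δ (ballEquivIcc A t))) = dist s t := by linarith
        exact h'⟩
  obtain ⟨L, hL⟩ := exists_linearIsometryEquiv_of_closedBall f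
  refine ⟨L, fun x => ?_⟩
  have h := hL ((ballEquivIcc A).symm x)
  have hf : f ((ballEquivIcc A).symm x) = (ballEquivIcc B).symm (Δ x) := by
    change (ballEquivIcc B).symm (Δ (ballEquivIcc A ((ballEquivIcc A).symm x))) = _
    rw [Equiv.apply_symm_apply]
  rw [hf] at h
  have hx : (((ballEquivIcc A).symm x : Metric.closedBall (0 : selfAdjoint A) 1) :
      selfAdjoint A) = (2 : ℝ) • ⟨x, IsSelfAdjoint.of_nonneg x.2.1⟩ - 1 := rfl
  -- The content is 2Δ(x) − 1 = L(2x − 1), to be solved for Δ(x).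
  rw [hx, map_sub, map_smul] at h
  have h' : (2 : ℝ) • (Δ x : B) - 1 =
      (2 : ℝ) • (L ⟨x, IsSelfAdjoint.of_nonneg x.2.1⟩ : B) - (L 1 : B) := congrArg Subtype.val h
  have h2 : (Δ x : B) = (2⁻¹ : ℝ) • (((2 : ℝ) • (Δ x : B) - 1) + 1) := by simp [smul_smul]
  rw [h2, h']
  module

end UnitInterval

/-! ### Complex linear extension from the self-adjoint part -/

section Complexification

open Complex ComplexStarModule

variable {A B : Type*} [CStarAlgebra A] [CStarAlgebra B]

/-- The complex linear extension of a real linear map between self-adjoint parts. -/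
noncomputable def complexify (L : selfAdjoint A →ₗ[ℝ] selfAdjoint B) : A →ₗ[ℂ] B where
  toFun a := (L (ℜ a) : B) + I • (L (ℑ a) : B)
  map_add' a b := by
    simp only [map_add, AddSubgroup.coe_add, smul_add]
    abel
  map_smul' z a := by
    simp only [realPart_smul, imaginaryPart_smul, map_sub, map_add, map_smul, RingHom.id_apply,
      AddSubgroup.coe_sub, AddSubgroup.coe_add, selfAdjoint.val_smul, ← Complex.coe_smul]
    generalize (L (ℜ a) : B) = u
    generalize (L (ℑ a) : B) = v
    match_scalars <;> apply Complex.ext <;> simp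

theorem complexify_apply (L : selfAdjoint A →ₗ[ℝ] selfAdjoint B) (a : A) :
    complexify L a = (L (ℜ a) : B) + I • (L (ℑ a) : B) := rfl

theorem complexify_coe (L : selfAdjoint A →ₗ[ℝ] selfAdjoint B) (a : selfAdjoint A) :
    complexify L a = L a := by
  simp [complexify_apply]

theorem complexify_star (L : selfAdjoint A →ₗ[ℝ] selfAdjoint B) (a : A) :
    complexify L (star a) = star (complexify L a) := by
  have h1 := realPart_add_I_smul_imaginaryPart a
  have h2 : star a = (ℜ a : A) - I • (ℑ a : A) := by
    conv_lhs => rw [← h1]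
    simp [(ℜ a).2.star_eq, (ℑ a).2.star_eq, sub_eq_add_neg]
  rw [h2, map_sub, map_smul, complexify_coe, complexify_coe, complexify_apply, star_add, star_smul,
    (L (ℜ a)).2.star_eq, (L (ℑ a)).2.star_eq]
  simp [sub_eq_add_neg]

theorem complexify_symm_complexify (L : selfAdjoint A ≃ₗ[ℝ] selfAdjoint B) (a : A) :
    complexify (L.symm : selfAdjoint B →ₗ[ℝ] selfAdjoint A)
      (complexify (L : selfAdjoint A →ₗ[ℝ] selfAdjoint B) a) = a := by
  rw [complexify_apply (L : selfAdjoint A →ₗ[ℝ] selfAdjoint B) a, map_add, map_smul,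
    complexify_coe, complexify_coe]
  simp [realPart_add_I_smul_imaginaryPart]

theorem complexify_bijective (L : selfAdjoint A ≃ₗ[ℝ] selfAdjoint B) :
    Function.Bijective (complexify (L : selfAdjoint A →ₗ[ℝ] selfAdjoint B)) :=
  Function.bijective_iff_has_inverse.2 ⟨complexify (L.symm : selfAdjoint B →ₗ[ℝ] selfAdjoint A),
    complexify_symm_complexify L, complexify_symm_complexify L.symm⟩

end Complexification

/-! ### From isometries fixing 0 to Jordan maps -/

section JordanOfIsometry

open ComplexStarModule

variable {A B : Type*} [CStarAlgebra A] [CStarAlgebra B]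

/-- Polarization handles self-adjoint pairs; decomposition into real and imaginary parts extends the
identity to each argument in turn. -/
theorem map_jordan_of_map_mul_self (T : A →ₗ[ℂ] B)
    (hsq : ∀ x : A, IsSelfAdjoint x → T (x * x) = T x * T x) (a b : A) :
    T (a * b + b * a) = T a * T b + T b * T a := by
  have h1 : ∀ a b : A, IsSelfAdjoint a → IsSelfAdjoint b →
      T (a * b + b * a) = T a * T b + T b * T a := by
    intro a b ha hb
    have h := hsq _ (ha.add hb)
    have e : (a + b) * (a + b) = a * a + (a * b + b * a) + b * b := by noncomm_ring
    rw [e, map_add, map_add T (a * a), hsq a ha, hsq b hb, map_add T a b] at h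
    have e2 : (T a + T b) * (T a + T b) = T a * T a + (T a * T b + T b * T a) + T b * T b := by
      noncomm_ring
    rw [e2] at h
    exact add_left_cancel (add_right_cancel h)
  have h2 : ∀ a b : A, IsSelfAdjoint b → T (a * b + b * a) = T a * T b + T b * T a := by
    intro a b hb
    have hr := h1 _ b (ℜ a).2 hb
    have hi := h1 _ b (ℑ a).2 hb
    rw [← realPart_add_I_smul_imaginaryPart a]
    generalize (ℜ a : A) = x at hr ⊢
    generalize (ℑ a : A) = y at hi ⊢
    have e : (x + Complex.I • y) * b + b * (x + Complex.I • y) =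
        (x * b + b * x) + Complex.I • (y * b + b * y) := by
      simp only [add_mul, mul_add, smul_mul_assoc, mul_smul_comm, smul_add]; abel
    rw [e, map_add, map_smul, hr, hi]
    simp only [map_add, map_smul, add_mul, mul_add, smul_mul_assoc, mul_smul_comm, smul_add]
    abel
  have hr := h2 a _ (ℜ b).2
  have hi := h2 a _ (ℑ b).2
  rw [← realPart_add_I_smul_imaginaryPart b]
  generalize (ℜ b : A) = x at hr ⊢
  generalize (ℑ b : A) = y at hi ⊢
  have e : a * (x + Complex.I • y) + (x + Complex.I • y) * a =
      (a * x + x * a) + Complex.I • (a * y + y * a) := by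
    simp only [add_mul, mul_add, smul_mul_assoc, mul_smul_comm, smul_add]; abel
  rw [e, map_add, map_smul, hr, hi]
  simp only [map_add, map_smul, add_mul, mul_add, smul_mul_assoc, mul_smul_comm, smul_add]
  abel

variable [PartialOrder A] [StarOrderedRing A]

/-- Every self-adjoint x is r(2y − 1) with y in [0,1], and preservation of squares passes through
this affine change because T is unital. Taking r = ‖x‖ + 1 covers x = 0. -/
theorem map_mul_self_of_isSelfAdjoint (T : A →ₗ[ℂ] B) (hone : T 1 = 1)
    (hsq : ∀ x ∈ Set.Icc (0 : A) 1, T (x * x) = T x * T x) {x : A} (hx : IsSelfAdjoint x) :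
    T (x * x) = T x * T x := by
  have hpos : 0 < ‖x‖ + 1 := by positivity
  have hsa : IsSelfAdjoint ((‖x‖ + 1)⁻¹ • x) := (IsSelfAdjoint.all _).smul hx
  have hn : ‖(‖x‖ + 1)⁻¹ • x‖ ≤ 1 := by
    rw [norm_smul, norm_inv, Real.norm_of_nonneg hpos.le, inv_mul_le_iff₀ hpos]
    linarith
  have hy := hsq _ (half_one_add_mem_Icc ⟨_, hsa⟩ hn)
  have hxy : x = ((‖x‖ + 1 : ℝ) : ℂ) • ((2 : ℂ) •
      ((2⁻¹ : ℝ) • (1 + (‖x‖ + 1)⁻¹ • x)) - 1) := by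
    have e : (2 : ℂ) • ((2⁻¹ : ℝ) • (1 + (‖x‖ + 1)⁻¹ • x)) = 1 + (‖x‖ + 1)⁻¹ • x := by
      rw [← Complex.coe_smul, smul_smul]; norm_num
    rw [e, add_sub_cancel_left, Complex.coe_smul, smul_smul, mul_inv_cancel₀ hpos.ne', one_smul]
  simp only at hy
  generalize (2⁻¹ : ℝ) • (1 + (‖x‖ + 1)⁻¹ • x) = y at hxy hy
  generalize ((‖x‖ + 1 : ℝ) : ℂ) = r at hxy
  rw [hxy]
  simp only [map_smul, map_sub, mul_sub, sub_mul, smul_mul_assoc, mul_smul_comm, one_mul, mul_one,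
    hone, hy, smul_sub]

variable [PartialOrder B] [StarOrderedRing B]

theorem inv_smul_mem_Icc {x : A} (hx : 0 ≤ x) : (‖x‖ + 1)⁻¹ • x ∈ Set.Icc (0 : A) 1 := by
  have hpos : 0 < ‖x‖ + 1 := by positivity
  have h0 : 0 ≤ (‖x‖ + 1)⁻¹ • x := smul_nonneg (inv_nonneg.2 hpos.le) hx
  refine ⟨h0, (CStarAlgebra.norm_le_one_iff_of_nonneg _ h0).1 ?_⟩
  rw [norm_smul, norm_inv, Real.norm_of_nonneg hpos.le, inv_mul_le_iff₀ hpos]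
  linarith

theorem map_nonneg_of_Icc (T : A →ₗ[ℂ] B) (hT : ∀ x ∈ Set.Icc (0 : A) 1, 0 ≤ T x)
    (x : A) (hx : 0 ≤ x) : 0 ≤ T x := by
  have hpos : 0 < ‖x‖ + 1 := by positivity
  have h := smul_nonneg hpos.le (hT _ (inv_smul_mem_Icc hx))
  rwa [← Complex.coe_smul, ← map_smul, Complex.coe_smul, smul_smul, mul_inv_cancel₀ hpos.ne',
    one_smul] at h

/-- Kadison for T gives T(x)² ≤ T(x²). Kadison for S at T x gives x² ≤ S(T(x)²), and applying the
monotone T yields the reverse inequality. -/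
theorem map_mul_self_of_Icc (T : A →ₗ[ℂ] B) (S : B →ₗ[ℂ] A) (hST : ∀ a, S (T a) = a)
    (hTS : ∀ b, T (S b) = b) (hT : ∀ x, 0 ≤ x → 0 ≤ T x) (hS : ∀ x, 0 ≤ x → 0 ≤ S x)
    (hone : T 1 = 1) {x : A} (hx : x ∈ Set.Icc (0 : A) 1) : T (x * x) = T x * T x := by
  have hS1 : S 1 = 1 := by rw [← hone, hST]
  have hmono : ∀ a b, a ≤ b → T a ≤ T b := fun a b h => by
    rw [← sub_nonneg, ← map_sub]; exact hT _ (sub_nonneg.2 h)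
  apply le_antisymm
  · have h := kadison_inequality (S.restrictScalars ℝ) hS hS1 (x := T x) (hT x hx.1)
      (by rw [← hone]; exact hmono _ _ hx.2)
    simp only [LinearMap.coe_restrictScalars, hST] at h
    simpa only [hTS] using hmono _ _ h
  · exact kadison_inequality (T.restrictScalars ℝ) hT hone hx.1 hx.2

/-- A surjective isometry of order intervals `[0, 1]` which fixes `0` is the restriction of a
Jordan ⋆-isomorphism. -/
theorem exists_jordanStarIso_of_map_zero (Δ : Set.Icc (0 : A) 1 ≃ᵢ Set.Icc (0 : B) 1)
    (h0 : ∀ x : Set.Icc (0 : A) 1, (x : A) = 0 → (Δ x : B) = 0) :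
    ∃ T : A →ₗ[ℂ] B, Function.Bijective T ∧ (∀ a, T (star a) = star (T a)) ∧
      (∀ a b, T (a * b + b * a) = T a * T b + T b * T a) ∧
      ∀ x : Set.Icc (0 : A) 1, (Δ x : B) = T x := by
  obtain ⟨L, hL⟩ := exists_linearIsometryEquiv_of_Icc Δ
  -- The translation part is Δ(0), so its vanishing makes L unital.
  have hc : (2⁻¹ : ℝ) • (1 - (L 1 : B)) = 0 := by
    have hΔ := hL ⟨0, le_rfl, zero_le_one⟩
    rw [h0 _ rfl] at hΔ
    have : (⟨0, IsSelfAdjoint.of_nonneg le_rfl⟩ : selfAdjoint A) = 0 := rfl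
    simp only [this, map_zero, ZeroMemClass.coe_zero, add_zero] at hΔ
    exact hΔ.symm
  have hL1 : (L 1 : B) = 1 := by
    rw [smul_eq_zero, sub_eq_zero] at hc
    exact (hc.resolve_left (by norm_num)).symm
  simp only [hc, zero_add] at hL
  let M : selfAdjoint A ≃ₗ[ℝ] selfAdjoint B := L.toLinearEquiv
  let T : A →ₗ[ℂ] B := complexify (M : selfAdjoint A →ₗ[ℝ] selfAdjoint B)
  let S : B →ₗ[ℂ] A := complexify (M.symm : selfAdjoint B →ₗ[ℝ] selfAdjoint A)
  have hTΔ : ∀ x : Set.Icc (0 : A) 1, (Δ x : B) = T x := fun x => by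
    rw [hL]
    exact (complexify_coe (M : selfAdjoint A →ₗ[ℝ] selfAdjoint B)
      ⟨x, IsSelfAdjoint.of_nonneg x.2.1⟩).symm
  have hST : ∀ a, S (T a) = a := complexify_symm_complexify M
  have hTS : ∀ b, T (S b) = b := complexify_symm_complexify M.symm
  have hone : T 1 = 1 := by
    rw [← hL1]
    exact complexify_coe (M : selfAdjoint A →ₗ[ℝ] selfAdjoint B) 1
  have hT : ∀ x, 0 ≤ x → 0 ≤ T x := map_nonneg_of_Icc T fun x hx => by
    rw [← hTΔ ⟨x, hx⟩]; exact (Δ ⟨x, hx⟩).2.1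
  -- Surjectivity of Δ makes the inverse positive: on [0,1], S agrees with Δ⁻¹.
  have hS : ∀ x, 0 ≤ x → 0 ≤ S x := map_nonneg_of_Icc S fun x hx => by
    have : T (Δ.symm ⟨x, hx⟩ : A) = x := by rw [← hTΔ, Δ.apply_symm_apply]
    rw [← this, hST]
    exact (Δ.symm ⟨x, hx⟩).2.1
  exact ⟨T, complexify_bijective M, complexify_star _,
    map_jordan_of_map_mul_self T fun _ => map_mul_self_of_isSelfAdjoint T hone
      fun _ => map_mul_self_of_Icc T S hST hTS hT hS hone, hTΔ⟩

/-- The isometry `x ↦ 1 - x` of the order interval `[0, 1]`. -/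
def oneSubIcc (A : Type*) [CStarAlgebra A] [PartialOrder A] [StarOrderedRing A] :
    Set.Icc (0 : A) 1 ≃ᵢ Set.Icc (0 : A) 1 :=
  IsometryEquiv.mk' (fun x => ⟨1 - x, sub_nonneg.2 x.2.2, sub_le_self _ x.2.1⟩)
    (fun x => ⟨1 - x, sub_nonneg.2 x.2.2, sub_le_self _ x.2.1⟩)
    (fun _ => Subtype.ext (sub_sub_cancel _ _))
    (Isometry.of_dist_eq fun _ _ => dist_sub_left _ _ _)

end JordanOfIsometry

/-! ### Primeness of B(H) and the metric geometry of projections -/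

section Projections

open InnerProductSpace

variable {H : Type*} [NormedAddCommGroup H] [InnerProductSpace ℂ H]

/-- The algebra of bounded operators is prime. -/
theorem eq_zero_or_eq_zero_of_mul_mul_eq_zero (a b : H →L[ℂ] H) (h : ∀ x, a * x * b = 0) :
    a = 0 ∨ b = 0 := by
  by_contra! hc
  obtain ⟨ha, hb⟩ := hc
  obtain ⟨y, hy⟩ : ∃ y, a y ≠ 0 := by
    by_contra! h; exact ha (ContinuousLinearMap.ext h)
  obtain ⟨z, hz⟩ : ∃ z, b z ≠ 0 := by
    by_contra! h; exact hb (ContinuousLinearMap.ext h)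
  -- This rank-one operator sends b z to ‖b z‖² y, which a does not kill.
  have := DFunLike.congr_fun (h (rankOne ℂ y (b z))) z
  simp [hy, hz] at this

theorem exists_unit_vector_of_ne_zero {e : H →L[ℂ] H} (he : e * e = e) (hne : e ≠ 0) :
    ∃ u : H, ‖u‖ = 1 ∧ e u = u := by
  obtain ⟨x, hx⟩ : ∃ x, e x ≠ 0 := by
    by_contra! h
    exact hne (ContinuousLinearMap.ext h)
  refine ⟨(‖e x‖⁻¹ : ℂ) • e x, norm_smul_inv_norm hx, ?_⟩
  rw [map_smul]
  congr 1
  exact DFunLike.congr_fun he x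

variable [CompleteSpace H]

/-- A nontrivial projection is not isolated among the projections. -/
theorem exists_projection_near {e : H →L[ℂ] H} (he : IsStarProjection e) (h0 : e ≠ 0)
    (h1 : e ≠ 1) : ∃ f : H →L[ℂ] H, IsStarProjection f ∧ f ≠ e ∧ ‖f - e‖ < 1 := by
  have hee : e * e = e := he.isIdempotentElem
  have hstar : ContinuousLinearMap.adjoint e = e := he.isSelfAdjoint
  obtain ⟨u, hu, heu⟩ := exists_unit_vector_of_ne_zero hee h0
  obtain ⟨v, hv, hev⟩ := exists_unit_vector_of_ne_zero he.one_sub.isIdempotentElem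
    (sub_ne_zero.2 (Ne.symm h1))
  have hev : e v = 0 := by simpa using hev
  have huv : inner ℂ u v = 0 := by
    calc inner ℂ u v = inner ℂ (e u) v := by rw [heu]
      _ = inner ℂ u (ContinuousLinearMap.adjoint e v) :=
        (ContinuousLinearMap.adjoint_inner_right e u v).symm
      _ = 0 := by rw [hstar, hev, inner_zero_right]
  have hvu : inner ℂ v u = 0 := inner_eq_zero_symm.1 huv
  have huu : inner ℂ u u = 1 := by rw [inner_self_eq_norm_sq_to_K, hu]; simp
  have hvv : inner ℂ v v = 1 := by rw [inner_self_eq_norm_sq_to_K, hv]; simp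
  -- The triple 5, 12, 13 gives a unit vector with rational coordinates: a slight rotation of u
  -- towards v.
  set w : H := (12 / 13 : ℂ) • u + (5 / 13 : ℂ) • v with hw
  have hww : inner ℂ w w = 1 := by
    simp only [hw, inner_add_left, inner_add_right, inner_smul_left, inner_smul_right, huu, hvv,
      huv, hvu, map_div₀, map_ofNat]
    norm_num
  have hwn : ‖w‖ = 1 := by
    have := inner_self_eq_norm_sq_to_K (𝕜 := ℂ) w
    rw [hww] at this
    have h' : ‖w‖ ^ 2 = 1 := by
      apply Complex.ofReal_injective
      rw [Complex.ofReal_pow, Complex.ofReal_one]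
      exact this.symm
    exact (pow_eq_one_iff_of_nonneg (norm_nonneg w) two_ne_zero).1 h'
  have huw : inner ℂ u w = 12 / 13 := by
    rw [hw, inner_add_right, inner_smul_right, inner_smul_right, huu, huv, mul_one, mul_zero,
      add_zero]
  let P := rankOne ℂ u u
  let Q := rankOne ℂ w w
  have hP : IsStarProjection P := isStarProjection_rankOne_self hu
  have hQ : IsStarProjection Q := isStarProjection_rankOne_self hwn
  have heP : e * P = P := by
    ext x; simp [P, heu]
  have hPe : P * e = P := by
    have := congrArg star heP
    rwa [star_mul, hP.isSelfAdjoint.star_eq, he.isSelfAdjoint.star_eq] at this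
  have hgw : (e - P) w = 0 := by
    simp only [sub_apply, P, rankOne_apply, huw]
    simp [hw, heu, hev]
  have hgQ : (e - P) * Q = 0 := by
    ext x
    have : (e - P) (Q x) = 0 := by
      simp only [Q, rankOne_apply, map_smul, hgw, smul_zero]
    simpa using this
  have hgsa : IsSelfAdjoint (e - P) := he.isSelfAdjoint.sub hP.isSelfAdjoint
  have hQg : Q * (e - P) = 0 := by
    have := congrArg star hgQ
    rwa [star_mul, hQ.isSelfAdjoint.star_eq, hgsa.star_eq, star_zero] at this
  have hgg : (e - P) * (e - P) = e - P := by
    rw [sub_mul, mul_sub, mul_sub, hee, heP, hPe, hP.isIdempotentElem.eq]; abel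
  -- In the range of e the line of u is exchanged for that of w, which e − P annihilates. As ‖w − u‖
  -- ≤ 6/13, the two rank-one terms of the difference total at most 12/13.
  refine ⟨(e - P) + Q, ⟨?_, hgsa.add hQ.isSelfAdjoint⟩, ?_, ?_⟩
  · change ((e - P) + Q) * ((e - P) + Q) = _
    rw [add_mul, mul_add, mul_add, hgg, hgQ, hQg, hQ.isIdempotentElem.eq]; abel
  · intro h
    have hPQ : Q = P := by
      rw [← sub_eq_zero] at h ⊢
      rw [← h]; abel
    -- The off-diagonal entry separates Q from P: it is 60/169 for Q and 0 for P.
    have h2 : inner ℂ v (Q u) = inner ℂ v (P u) := by rw [hPQ]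
    have hwu : inner ℂ w u = 12 / 13 := by
      rw [← inner_conj_symm, huw, map_div₀, map_ofNat, map_ofNat]
    have hvw : inner ℂ v w = 5 / 13 := by
      rw [hw, inner_add_right, inner_smul_right, inner_smul_right, hvv, hvu, mul_one, mul_zero,
        zero_add]
    simp only [Q, P, rankOne_apply, inner_smul_right, hvu, hwu, hvw] at h2
    norm_num at h2
  · have hd : (e - P) + Q - e = rankOne ℂ (w - u) w + rankOne ℂ u (w - u) := by
      simp only [map_sub, sub_apply, P, Q]
      abel
    have hwu : ‖w - u‖ ≤ 6 / 13 := by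
      have : w - u = (-1 / 13 : ℂ) • u + (5 / 13 : ℂ) • v := by rw [hw]; module
      rw [this]
      refine (norm_add_le _ _).trans ?_
      rw [norm_smul, norm_smul, hu, hv]
      norm_num
    rw [hd]
    refine (norm_add_le _ _).trans_lt ?_
    rw [norm_rankOne, norm_rankOne, hwn, hu]
    linarith

/-- The C⋆-identity gives ‖p‖² = ‖p‖. This isolates 0 among the projections. -/
theorem eq_zero_of_isStarProjection_of_norm_lt_one {p : H →L[ℂ] H} (hp : IsStarProjection p)
    (h : ‖p‖ < 1) : p = 0 := by
  have h2 := hp.isSelfAdjoint.norm_mul_self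
  rw [hp.isIdempotentElem.eq] at h2
  by_contra hne
  have : 0 < ‖p‖ := norm_pos_iff.2 hne
  nlinarith

theorem mem_posBall_iff {x : H →L[ℂ] H} : x ∈ posBall H ↔ x ∈ Set.Icc (0 : H →L[ℂ] H) 1 := by
  rw [posBall, Set.mem_ofPred_eq, ← ContinuousLinearMap.nonneg_iff_isPositive, Set.mem_Icc]
  exact and_congr_right fun h => CStarAlgebra.norm_le_one_iff_of_nonneg x h

end Projections

/-! ### Value at 0, the multiplicative dichotomy and assembly -/

section Main

variable {H₁ H₂ : Type*}
    [NormedAddCommGroup H₁] [InnerProductSpace ℂ H₁] [CompleteSpace H₁]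
    [NormedAddCommGroup H₂] [InnerProductSpace ℂ H₂] [CompleteSpace H₂]

/-- A projection preserving surjective isometry of positive unit balls maps `0` to `0` or `1`. -/
theorem map_zero_eq_zero_or_one (Δ : posBall H₁ → posBall H₂) (hiso : Isometry Δ)
    (hproj : Subtype.val '' (Δ '' (Subtype.val ⁻¹' projections H₁)) = projections H₂)
    (z : posBall H₁) (hz : (z : H₁ →L[ℂ] H₁) = 0) :
    (Δ z : H₂ →L[ℂ] H₂) = 0 ∨ (Δ z : H₂ →L[ℂ] H₂) = 1 := by
  by_contra! hc
  have he : (Δ z : H₂ →L[ℂ] H₂) ∈ projections H₂ := by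
    rw [← hproj]
    refine ⟨_, ⟨z, ?_, rfl⟩, rfl⟩
    rw [Set.mem_preimage, hz]
    exact IsStarProjection.zero _
  obtain ⟨f, hf, hne, hlt⟩ := exists_projection_near he hc.1 hc.2
  have hf' : f ∈ projections H₂ := hf
  rw [← hproj] at hf'
  obtain ⟨_, ⟨p, hp, rfl⟩, rfl⟩ := hf'
  -- A projection near Δ(0) pulls back to a projection p with ‖p‖ < 1, forcing p = 0.
  have hd := hiso.dist_eq p z
  rw [Subtype.dist_eq, Subtype.dist_eq, hz, dist_zero_right, dist_eq_norm] at hd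
  have hp0 := eq_zero_of_isStarProjection_of_norm_lt_one hp (hd ▸ hlt)
  exact hne (by rw [Subtype.ext (hp0.trans hz.symm)])

/-- A Jordan ⋆-isomorphism between algebras of bounded operators is a ⋆-isomorphism or a
⋆-anti-isomorphism. -/
theorem isStarIso_or_isStarAntiIso (T : (H₁ →L[ℂ] H₁) →ₗ[ℂ] (H₂ →L[ℂ] H₂))
    (hbij : Function.Bijective T) (hstar : ∀ a, T (star a) = star (T a))
    (hJ : ∀ a b, T (a * b + b * a) = T a * T b + T b * T a) :
    IsStarIso T ∨ IsStarAntiIso T := by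
  refine (jordanHom_mul_or_mul_rev (T : (H₁ →L[ℂ] H₁) →+ (H₂ →L[ℂ] H₂)) (fun s hs => ?_) hJ
    eq_zero_or_eq_zero_of_mul_mul_eq_zero hbij.2).imp (fun h => ?_) (fun h => ?_)
  · rw [← two_smul ℂ, smul_eq_zero] at hs
    exact hs.resolve_left two_ne_zero
  · exact ⟨{ Equiv.ofBijective T hbij with
      map_mul' := h
      map_add' := map_add T
      map_star' := hstar
      map_smul' := map_smul T }, fun a => rfl⟩
  · exact ⟨{ (Equiv.ofBijective T hbij).trans MulOpposite.opEquiv with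
      map_mul' := fun a b => congrArg MulOpposite.op (h a b)
      map_add' := fun a b => congrArg MulOpposite.op (map_add T a b)
      map_star' := fun a => congrArg MulOpposite.op (hstar a)
      map_smul' := fun r a => congrArg MulOpposite.op (map_smul T r a) }, fun a => rfl⟩

theorem norm_starAlgEquiv {A B : Type*} [CStarAlgebra A] [CStarAlgebra B] (Φ : A ≃⋆ₐ[ℂ] B)
    (a : A) : ‖Φ a‖ = ‖a‖ :=
  StarAlgEquiv.norm_map Φ a

/-- A ⋆-isomorphism of C⋆-algebras preserves norms; an anti-isomorphism is one onto the opposite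
algebra, which has the same norm. -/
theorem isometry_of_isStarIso_or_isStarAntiIso (T : (H₁ →L[ℂ] H₁) →ₗ[ℂ] (H₂ →L[ℂ] H₂))
    (h : IsStarIso T ∨ IsStarAntiIso T) : Isometry T := by
  refine AddMonoidHomClass.isometry_of_norm T fun a => ?_
  rcases h with ⟨Φ, hΦ⟩ | ⟨Φ, hΦ⟩
  · rw [hΦ, norm_starAlgEquiv]
  · rw [← MulOpposite.norm_op, hΦ, norm_starAlgEquiv]

/-- The identification of the positive unit ball with the order interval `[0, 1]`. -/
def posBallEquivIcc (H : Type*) [NormedAddCommGroup H] [InnerProductSpace ℂ H] [CompleteSpace H] :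
    posBall H ≃ᵢ Set.Icc (0 : H →L[ℂ] H) 1 :=
  ⟨Equiv.setCongr (Set.ext fun _ => mem_posBall_iff), fun _ _ => rfl⟩

theorem exists_isJordanStarIso_of_Icc
    (D : Set.Icc (0 : H₁ →L[ℂ] H₁) 1 ≃ᵢ Set.Icc (0 : H₂ →L[ℂ] H₂) 1)
    (h0 : ∀ x : Set.Icc (0 : H₁ →L[ℂ] H₁) 1, (x : H₁ →L[ℂ] H₁) = 0 → (D x : H₂ →L[ℂ] H₂) = 0) :
    ∃ T : (H₁ →L[ℂ] H₁) →ₗ[ℂ] (H₂ →L[ℂ] H₂), Function.Surjective T ∧ Isometry T ∧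
      IsJordanStarIso T ∧ (∀ x, (D x : H₂ →L[ℂ] H₂) = T x) ∧ (IsStarIso T ∨ IsStarAntiIso T) := by
  obtain ⟨T, hbij, hstar, hJ, hD⟩ := exists_jordanStarIso_of_map_zero D h0
  have hiso := isStarIso_or_isStarAntiIso T hbij hstar hJ
  refine ⟨T, hbij.2, isometry_of_isStarIso_or_isStarAntiIso T hiso, ⟨⟨hstar, fun a b => ?_⟩, hbij⟩,
    hD, hiso⟩
  rw [jordanProd, jordanProd, map_smul, hJ]

end Main

theorem lemmal {H₁ H₂ : Type*}
    [NormedAddCommGroup H₁] [InnerProductSpace ℂ H₁] [CompleteSpace H₁]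
    [NormedAddCommGroup H₂] [InnerProductSpace ℂ H₂] [CompleteSpace H₂]
    (Δ : posBall H₁ → posBall H₂) (hiso : Isometry Δ) (hsurj : Function.Surjective Δ)
    (hproj : Subtype.val '' (Δ '' (Subtype.val ⁻¹' projections H₁)) = projections H₂) :
    ∃ T : (H₁ →L[ℂ] H₁) →ₗ[ℂ] (H₂ →L[ℂ] H₂),
      Function.Surjective T ∧ Isometry T ∧ IsJordanStarIso T ∧
      ((∀ x : posBall H₁, (Δ x : H₂ →L[ℂ] H₂) = T x) ∨
        (∀ x : posBall H₁, (Δ x : H₂ →L[ℂ] H₂) = 1 - T x)) ∧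
      (IsStarIso T ∨ IsStarAntiIso T) := by
  let Δe : posBall H₁ ≃ᵢ posBall H₂ := ⟨Equiv.ofBijective Δ ⟨hiso.injective, hsurj⟩, hiso⟩
  let D : Set.Icc (0 : H₁ →L[ℂ] H₁) 1 ≃ᵢ Set.Icc (0 : H₂ →L[ℂ] H₂) 1 :=
    (posBallEquivIcc H₁).symm.trans (Δe.trans (posBallEquivIcc H₂))
  have hD : ∀ x : posBall H₁, (D (posBallEquivIcc H₁ x) : H₂ →L[ℂ] H₂) = Δ x := fun x => rfl
  let z : posBall H₁ := ⟨0, mem_posBall_iff.2 ⟨le_rfl, zero_le_one⟩⟩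
  rcases map_zero_eq_zero_or_one Δ hiso hproj z rfl with h | h
  · obtain ⟨T, hs, hi, hj, hT, hor⟩ := exists_isJordanStarIso_of_Icc D fun x hx => by
      have : x = posBallEquivIcc H₁ z := Subtype.ext hx
      rw [this, hD, h]
    exact ⟨T, hs, hi, hj, Or.inl fun x => by rw [← hD, hT]; rfl, hor⟩
  -- Following Δ by y ↦ 1 − y sends 0 to 0 and reduces to the previous case.
  · obtain ⟨T, hs, hi, hj, hT, hor⟩ := exists_isJordanStarIso_of_Icc
      (D.trans (oneSubIcc (H₂ →L[ℂ] H₂))) fun x hx => by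
        have : x = posBallEquivIcc H₁ z := Subtype.ext hx
        change 1 - (D x : H₂ →L[ℂ] H₂) = 0
        rw [this, hD, h, sub_self]
    refine ⟨T, hs, hi, hj, Or.inr fun x => ?_, hor⟩
    have hx : 1 - (Δ x : H₂ →L[ℂ] H₂) = T x := hT (posBallEquivIcc H₁ x)
    rw [← hx, sub_sub_cancel]
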